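/- Let $\mathcal M$ be a transversal matroid of rank $r$ on $[n]$ with a presentation $(A_1,\dots,A_r)$: its bases are the sets of elements of $[n]$ covered by the matchings of maximum size in the bipartite graph with edges $(x,j)$, $x\in A_j$. The type of $x\in[n]$ is $\phi(x)=\{j: x\in A_j\}$, and $l_{I}=l_{\mathcal M,I}$ is the number of $x$ of type $I\subseteq[r]$. Order the subsets of $[r]$ by $I\prec I'$ if $|I|<|I'|$, or $|I|=|I'|$ and $I$ is lexicographically smaller; let $I_1\prec\dots\prec I_m$ be the types with $l_{I_i}>0$. For $J\subseteq\{0,1,\dots,r\}$ let $\Delta_J\subset\mathbb R^r$ be the convex hull of the $e_j$, $j\in J$, where $e_0=0$. The transversalhedron is $P_{\mathcal M}=\sum_{I\subseteq[r]} l_I\Delta_{\{0\}\cup I}$. For a sequence $a=(a_1,\dots,a_m)$ let $\mathcal I^a$ be the multiset in which each $I_i$ occurs $a_i$ times; a multiset of subsets of $[r]$ is maximal valid if it has $r$ members and the union of any $t$ of its members has at least $t$ elements. $EP_{\mathcal M}(\mathcal I^a)$ is the set of $I\subseteq[r]$ for which there is $I'\subseteq[r]$ with $I\prec I'$ such that $(\mathcal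 I^a\setminus\{I'\})\cup\{I\}$ (one occurrence of $I'$ removed) is maximal valid. The canonical subdivision of $P_{\mathcal M}$ is the following set of cells $\sum_i l_{I_i}\Delta_{J_i}$. Suppose first that $l_{\{j\}}\ge1$ for all $j\in[r]$. Start with the single cell in which $J_I=\{0\}\cup I$ for the types $I$ with $|I|\le1$. Treat the occurring types with at least two elements in increasing order. For such a type $I_k$ let $P'=\sum_{I\prec I_k}l_I\Delta_{\{0\}\cup I}$, which is already subdivided. The faces of a cell $\sum_I l_I\Delta_{J_I}$ are the sums $\sum_I l_I\Delta_{F_I}$ with $\emptyset\ne F_I\subseteq J_I$; the nontrivial boundary of $P'$ is the part of $P'$ on the hyperplanes $\sum_{j\in H}x_j=\sum_{I\prec I_k,\,I\cap H\ne\emptyset}l_I$ with $\emptyset\neq H\subseteq[r]$, and a face is said to lie on it if it is contained in one of these hyperplanes. A facet $K$ of a cell that lies on the nontrivial boundary is free in direction $j$ if $x+\varepsilon e_j\notin P'$ for all $x\in K$ and $\varepsilon>0$; it is labeled with the least $t\in I_k$ in whose direction it is free (if there is one). A face $F$ of a cell that lies on the nontrivial boundary is labeled with the set $T$ of the labels of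 those facets of cells on the nontrivial boundary that contain $F$, and is saturated if $|T|$ is the codimension of $F$ in $\mathbb R^r$. Keep all old cells, with $J_{I_k}=\{0\}$, and add the cell $F+l_{I_k}\Delta_{\{0\}\cup T}$ for each saturated face $F$ with label $T$. If some singleton types $\{j\}$ do not occur, add one element of each of these types, take the cells of the resulting canonical subdivision that lie in the region $x_j\ge1$ for all these $j$, and drop the summands of the added types. The type of a cell $\sum_i l_{I_i}\Delta_{J_i}$ is $\mathcal I^a$ with $a_i=|J_i|-1$. Lemma. For every cell $l_{I_1}\Delta_{J_1}+\dots+l_{I_m}\Delta_{J_m}$ of the canonical subdivision of $P_{\mathcal M}$, with type $\mathcal I^a$, and every $i$: $0\notin J_i$ if and only if $I_i\in EP_{\mathcal M}(\mathcal I^a)$. -/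

import Mathlib

open scoped Pointwise

namespace Transversalhedron

/-! ### Transversal matroids and types -/

/-- A matching of the bipartite graph of the family `A`, whose edges are the pairs `(x, j)` with
`x ∈ A j`, given as a finite set of edges no two of which share an endpoint. -/
def IsMatching {n r : ℕ} (A : Fin r → Finset (Fin n)) (T : Finset (Fin n × Fin r)) : Prop :=
  (∀ e ∈ T, e.1 ∈ A e.2) ∧
    ∀ e ∈ T, ∀ e' ∈ T, (e.1 = e'.1 ∨ e.2 = e'.2) → e = e'

/-- `A` is a presentation of the matroid `M` on `[n]`: the bases of `M` are the sets of left
endpoints of the matchings of maximum size. -/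
def IsPresentation {n r : ℕ} (M : Matroid (Fin n)) (A : Fin r → Finset (Fin n)) : Prop :=
  M.E = Set.univ ∧
    ∀ B : Finset (Fin n), M.IsBase (B : Set (Fin n)) ↔
      ∃ T, IsMatching A T ∧ (∀ T', IsMatching A T' → T'.card ≤ T.card) ∧ T.image Prod.fst = B

/-- The type `φ(x)` of an element `x` of the ground set. -/
def elemType {n r : ℕ} (A : Fin r → Finset (Fin n)) (x : Fin n) : Finset (Fin r) :=
  Finset.univ.filter fun j => x ∈ A j

/-- The number `l_{M,I}` of elements of type `I`. -/
def mult {n r : ℕ} (A : Fin r → Finset (Fin n)) (I : Finset (Fin r)) : ℕ :=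
  (Finset.univ.filter fun x => elemType A x = I).card

/-- Sort key for the order on subsets of `[r]`: first by cardinality, then lexicographically
(on the increasing lists of elements). -/
def precKey {r : ℕ} (I : Finset (Fin r)) : ℕ ×ₗ List (Fin r) :=
  toLex (I.card, I.sort (· ≤ ·))

/-- The strict total order `I ≺ I'` on subsets of `[r]`. -/
def Prec {r : ℕ} (I I' : Finset (Fin r)) : Prop := precKey I < precKey I'

/-- The weak version `I ⪯ I'` of the order. -/
def PrecEq {r : ℕ} (I I' : Finset (Fin r)) : Prop := precKey I ≤ precKey I'

instance {r : ℕ} : DecidableRel (Prec (r := r)) := fun I I' =>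
  inferInstanceAs (Decidable (precKey I < precKey I'))

instance {r : ℕ} : DecidableRel (PrecEq (r := r)) := fun I I' =>
  inferInstanceAs (Decidable (precKey I ≤ precKey I'))

theorem precKey_injective {r : ℕ} : Function.Injective (precKey (r := r)) := by
  intro I I' h
  have h2 : I.sort (· ≤ ·) = I'.sort (· ≤ ·) := congrArg (fun p => (ofLex p).2) h
  rw [← Finset.sort_toFinset I (· ≤ ·), h2, Finset.sort_toFinset]

instance {r : ℕ} : IsTrans (Finset (Fin r)) PrecEq := ⟨fun _ _ _ h h' => le_trans h h'⟩

instance {r : ℕ} : Std.Antisymm (PrecEq (r := r)) :=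
  ⟨fun _ _ h h' => precKey_injective (le_antisymm h h')⟩

instance {r : ℕ} : Std.Total (PrecEq (r := r)) := ⟨fun _ _ => le_total _ _⟩

/-- The collection `𝓘^a`, in which each `I` occurs `a I` times. -/
def collection {r : ℕ} (a : Finset (Fin r) → ℕ) : Multiset (Finset (Fin r)) :=
  ∑ I, Multiset.replicate (a I) I

/-- Hall's condition: the union of any `t` sets of the collection has at least `t` elements. -/
def IsValid {r : ℕ} (τ : Multiset (Finset (Fin r))) : Prop :=
  ∀ s ≤ τ, Multiset.card s ≤ s.sup.card

/-- A maximal valid collection: it satisfies Hall's condition and has `r` members. -/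
def IsMaximalValid {r : ℕ} (τ : Multiset (Finset (Fin r))) : Prop :=
  IsValid τ ∧ Multiset.card τ = r

/-- The set `EP(τ)` of the `I ⊆ [r]` that may replace one occurrence of some `I' ≻ I` in `τ` so
that the result is again a maximal valid collection. (If `I'` does not occur in `τ`, nothing is
removed and, for a maximal `τ`, the result is too large to be maximal.) -/
def EP {r : ℕ} (τ : Multiset (Finset (Fin r))) : Set (Finset (Fin r)) :=
  {I | ∃ I', Prec I I' ∧ IsMaximalValid (I ::ₘ τ.erase I')}

/-! ### Transversalhedra and Minkowski faces

The label set `{0, 1, …, r}` is `Fin (r + 1)`; the element `j` of `[r]`, modelled by `Fin r`,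
is the label `j.succ`. -/

/-- The set of labels `{0} ∪ T`, for `T ⊆ [r]`. -/
def withZero {r : ℕ} (T : Finset (Fin r)) : Finset (Fin (r + 1)) :=
  insert 0 (T.map (Fin.succEmb r))

/-- The point of `ℝ^r` with a given label: the origin for `0`, the basis vector `e_j` for `j`. -/
def vert {r : ℕ} : Fin (r + 1) → (Fin r → ℝ) :=
  Fin.cases 0 fun j => Pi.single j 1

/-- The simplex `Δ_J`, for `J ⊆ {0, …, r}`. -/
def simplex {r : ℕ} (J : Finset (Fin (r + 1))) : Set (Fin r → ℝ) :=
  convexHull ℝ (vert '' (J : Set (Fin (r + 1))))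

/-- The Minkowski sum `∑_I l_I Δ_{J_I}`. All families `J` in use have `J I = {0}` whenever
`l I = 0`. -/
def minkowskiSum {r : ℕ} (l : Finset (Fin r) → ℕ) (J : Finset (Fin r) → Finset (Fin (r + 1))) :
    Set (Fin r → ℝ) :=
  ∑ I, (l I : ℝ) • simplex (J I)

/-- The transversalhedron `∑_I l_I Δ_{{0} ∪ I}`. -/
def transversalhedron {r : ℕ} (l : Finset (Fin r) → ℕ) : Set (Fin r → ℝ) :=
  minkowskiSum l withZero

/-- The dimension of a set: the dimension of its affine span. -/
noncomputable def dim {r : ℕ} (S : Set (Fin r → ℝ)) : ℕ :=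
  Module.finrank ℝ (vectorSpan ℝ S)

/-- The family `F` describes a Minkowski face of a cell from `𝒟`. The faces of a fine cell
`∑_I l_I Δ_{J_I}` are the sums `∑_I l_I Δ_{F_I}` with `∅ ≠ F_I ⊆ J_I`. -/
def IsMinkowskiFace {r : ℕ} (𝒟 : Set (Finset (Fin r) → Finset (Fin (r + 1))))
    (F : Finset (Fin r) → Finset (Fin (r + 1))) : Prop :=
  ∃ J ∈ 𝒟, ∀ I, (F I).Nonempty ∧ F I ⊆ J I

/-- `S` lies on the nontrivial boundary of the transversalhedron of `l`, that is, on one of the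
hyperplanes `x_H = ∑_{I ∩ H ≠ ∅} l_I`. -/
def OnNontrivialBoundary {r : ℕ} (l : Finset (Fin r) → ℕ) (S : Set (Fin r → ℝ)) : Prop :=
  ∃ H : Finset (Fin r), H.Nonempty ∧
    ∀ x ∈ S, ∑ j ∈ H, x j = ∑ I with (I ∩ H).Nonempty, (l I : ℝ)

/-- The set of directions in which `S` is free: moving from any point of `S` in the positive
direction of the axis `j` leaves the transversalhedron of `l`. -/
def freeDirections {r : ℕ} (l : Finset (Fin r) → ℕ) (S : Set (Fin r → ℝ)) : Set (Fin r) :=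
  {j | ∀ x ∈ S, ∀ ε : ℝ, 0 < ε → x + ε • Pi.single j 1 ∉ transversalhedron l}

/-- The label of a Minkowski face `F` on the nontrivial boundary, with respect to the next type
`I₀`: the set of those `t` for which some Minkowski facet `K` on the nontrivial boundary contains
`F` and has `t` as the least element of `I₀` in which it is free. -/
def faceLabel {r : ℕ} (l : Finset (Fin r) → ℕ)
    (𝒟 : Set (Finset (Fin r) → Finset (Fin (r + 1)))) (I₀ : Finset (Fin r))
    (F : Finset (Fin r) → Finset (Fin (r + 1))) : Set (Fin r) :=
  {t | ∃ K, IsMinkowskiFace 𝒟 K ∧ dim (minkowskiSum l K) + 1 = r ∧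
      OnNontrivialBoundary l (minkowskiSum l K) ∧
      minkowskiSum l F ⊆ minkowskiSum l K ∧
      IsLeast (freeDirections l (minkowskiSum l K) ∩ (I₀ : Set (Fin r))) t}

/-- `F` is a saturated Minkowski face on the nontrivial boundary, labeled with `T`: the number of
elements of `T` is the codimension of `F`. -/
def IsSaturated {r : ℕ} (l : Finset (Fin r) → ℕ)
    (𝒟 : Set (Finset (Fin r) → Finset (Fin (r + 1)))) (I₀ : Finset (Fin r))
    (F : Finset (Fin r) → Finset (Fin (r + 1))) (T : Finset (Fin r)) : Prop :=
  IsMinkowskiFace 𝒟 F ∧ OnNontrivialBoundary l (minkowskiSum l F) ∧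
    (T : Set (Fin r)) = faceLabel l 𝒟 I₀ F ∧ dim (minkowskiSum l F) + T.card = r

/-! ### The canonical subdivision -/

/-- The multiplicities of the restriction to the types that precede `I₀`. -/
def before {r : ℕ} (l : Finset (Fin r) → ℕ) (I₀ I : Finset (Fin r)) : ℕ :=
  if Prec I I₀ then l I else 0

/-- One extension step: given a subdivision `𝒟` of the transversalhedron of the types that precede
`I₀`, keep its cells (with the new summand `Δ_{{0}}`) and add the cell `F + l_{I₀} Δ_{{0} ∪ T}` for
each saturated face `F` labeled with `T`. -/
def extend {r : ℕ} (l : Finset (Fin r) → ℕ)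
    (𝒟 : Set (Finset (Fin r) → Finset (Fin (r + 1)))) (I₀ : Finset (Fin r)) :
    Set (Finset (Fin r) → Finset (Fin (r + 1))) :=
  𝒟 ∪ {J | ∃ F T, IsSaturated (before l I₀) 𝒟 I₀ F T ∧ J = Function.update F I₀ (withZero T)}

/-- The single cell of the transversalhedron of the types with at most one element. -/
def initialCell {r : ℕ} (I : Finset (Fin r)) : Finset (Fin (r + 1)) :=
  if I.card ≤ 1 then withZero I else {0}

/-- The occurring types with at least two elements, in increasing order. -/
def laterTypes {r : ℕ} (l : Finset (Fin r) → ℕ) : List (Finset (Fin r)) :=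
  (Finset.univ.filter fun I => 2 ≤ I.card ∧ 0 < l I).sort PrecEq

/-- The canonical subdivision when all singleton types occur: start from the single cell and extend
by the remaining types one after the other. -/
def canonicalOfSingletons {r : ℕ} (l : Finset (Fin r) → ℕ) :
    Set (Finset (Fin r) → Finset (Fin (r + 1))) :=
  (laterTypes l).foldl (extend l) {initialCell}

/-- The multiplicities `l` with one element of type `{i}` added for each singleton type that does
not occur. -/
def fillSingletons {r : ℕ} (l : Finset (Fin r) → ℕ) (I : Finset (Fin r)) : ℕ :=
  if I.card = 1 then max 1 (l I) else l I

/-- The canonical subdivision of the transversalhedron of `l`, as the set of the families `J` that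
describe its cells `∑_I l_I Δ_{J_I}`. If singleton types `{i}` are missing, add them, take the cells
in the region given by `x_i ≥ l_{{i}}` for these `i`, and drop the added summands. -/
def canonicalSubdivision {r : ℕ} (l : Finset (Fin r) → ℕ) :
    Set (Finset (Fin r) → Finset (Fin (r + 1))) :=
  {J | ∃ J' ∈ canonicalOfSingletons (fillSingletons l),
    (∀ i : Fin r, l {i} = 0 →
      ∀ x ∈ minkowskiSum (fillSingletons l) J', (fillSingletons l {i} : ℝ) ≤ x i) ∧
    ∀ I, J I = if l I = 0 then {0} else J' I}

/-- The type `𝓘^a` of the fine cell described by `J`, where `a_I = |J_I| - 1`. -/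
def cellType {r : ℕ} (J : Finset (Fin r) → Finset (Fin (r + 1))) : Multiset (Finset (Fin r)) :=
  collection fun I => (J I).card - 1

end Transversalhedron

open Transversalhedron

/-!
Every cell of the canonical subdivision is full-dimensional and fine, so `ℝ^r` is the direct sum
of the edge spaces of its summands. Hence Hall's condition for the type of the cell is a dimension
count in the coordinate subspaces, and `S` is a tight set if and only if the edge spaces of the
types `I ⊆ S` span the coordinate subspace of `S`.

There are certificates for both cases. That `I ∉ EP` is certified by a tight set `S ⊇ I` that
contains no later member of the type. That `0 ∉ J_I` is certified by a functional `∑_{j ∈ Y} x_j`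
that is `1` on the vertices of `Δ_{J_I}` and constant on the summands of all earlier types. They
exclude each other, because the functional would vanish on the coordinate subspace of `S`.

The certificates survive the extension across a saturated face `F` with label `T`. The sets `H` of
the facets that produce the labels are triangular with respect to `T`, so the direction space of
`F` is complementary to the coordinate subspace of `T`. Comparing dimensions, with `U` the union of
these `H`, the set `Uᶜ` is tight and `F` agrees with its cell on the types contained in `Uᶜ`, so
that old tight sets can be intersected with `Uᶜ`. On the remaining types `F` lies in the face where
`∑_{j ∈ U} x_j` is maximal, so `U` provides the functional whenever `0` has been lost.
-/

namespace Transversalhedron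

/-! ### Dimension of direct sums and of Minkowski sums -/

section LinearAlgebra

variable {ι k V : Type*}

theorem iSupIndep_iff_finrank_iSup [DivisionRing k] [AddCommGroup V] [Module k V] [Fintype ι]
    (W : ι → Submodule k V) [∀ i, FiniteDimensional k (W i)] :
    iSupIndep W ↔ Module.finrank k ↥(⨆ i, W i) = ∑ i, Module.finrank k (W i) := by
  classical
  set f := DFinsupp.lsum ℕ fun i => (W i).subtype
  have hrange : ⨆ i, W i = LinearMap.range f := Submodule.iSup_eq_range_dfinsupp_lsum W
  have : FiniteDimensional k (Π₀ i, W i) := inferInstanceAs (Module.Finite k (DirectSum ι _))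
  have hdim : Module.finrank k (Π₀ i, W i) = ∑ i, Module.finrank k (W i) :=
    Module.finrank_directSum k fun i => W i
  have hrank := f.finrank_range_add_finrank_ker
  rw [iSupIndep_iff_dfinsupp_lsum_injective, ← LinearMap.ker_eq_bot,
    ← Submodule.finrank_eq_zero (R := k), hrange, ← hdim]
  change Module.finrank k (LinearMap.ker f) = 0 ↔ _
  lia

theorem finrank_biSup_of_iSupIndep [DivisionRing k] [AddCommGroup V] [Module k V]
    {W : ι → Submodule k V} (hW : iSupIndep W) [∀ i, FiniteDimensional k (W i)] (D : Finset ι) :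
    Module.finrank k ↥(⨆ i ∈ D, W i) = ∑ i ∈ D, Module.finrank k (W i) := by
  have hD : iSupIndep fun i : D => W i := hW.comp Subtype.val_injective
  rw [← Finset.sum_coe_sort, ← (iSupIndep_iff_finrank_iSup _).1 hD, iSup_subtype]

theorem vectorSpan_add [Ring k] [AddCommGroup V] [Module k V] {s t : Set V} (hs : s.Nonempty)
    (ht : t.Nonempty) : vectorSpan k (s + t) = vectorSpan k s ⊔ vectorSpan k t := by
  let f := (LinearMap.id : V →ₗ[k] V).coprod LinearMap.id
  have himage : s + t = f.toAffineMap '' (s ×ˢ t) := Set.add_image_prod.symm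
  rw [himage, ← AffineMap.map_vectorSpan, vectorSpan_prod_eq hs ht, LinearMap.toAffineMap_linear,
    LinearMap.map_coprod_prod, Submodule.map_id, Submodule.map_id]

theorem vectorSpan_smul [Field k] [AddCommGroup V] [Module k V] {c : k} (hc : c ≠ 0) (s : Set V) :
    vectorSpan k (c • s) = vectorSpan k s := by
  have himage : c • s = (c • LinearMap.id : V →ₗ[k] V).toAffineMap '' s := rfl
  rw [himage, ← AffineMap.map_vectorSpan, LinearMap.toAffineMap_linear,
    Submodule.map_smul _ _ _ hc, Submodule.map_id]

theorem vectorSpan_sum [Ring k] [AddCommGroup V] [Module k V] {s : ι → Set V}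
    (hs : ∀ i, (s i).Nonempty) (D : Finset ι) :
    vectorSpan k (∑ i ∈ D, s i) = ⨆ i ∈ D, vectorSpan k (s i) := by
  classical
  suffices (∑ i ∈ D, s i).Nonempty ∧ vectorSpan k (∑ i ∈ D, s i) = ⨆ i ∈ D, vectorSpan k (s i) from
    this.2
  induction D using Finset.induction_on with
  | empty => simp [Set.singleton_nonempty, ← Set.singleton_zero]
  | insert i D hi ih =>
    rw [Finset.sum_insert hi, Finset.iSup_insert, vectorSpan_add (hs i) ih.1, ih.2]
    exact ⟨(hs i).add ih.1, rfl⟩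

/-- Positive multiples of differences of points of a convex set are closed under addition, so they
exhaust the direction space. -/
theorem exists_pos_smul_mem_of_mem_vectorSpan [Field k] [LinearOrder k] [IsStrictOrderedRing k]
    [AddCommGroup V] [Module k V] {s : Set V} (hs : Convex k s) (hne : s.Nonempty) {d : V}
    (hd : d ∈ vectorSpan k s) : ∃ x ∈ s, ∃ c : k, 0 < c ∧ x + c • d ∈ s := by
  suffices ∃ x ∈ s, ∃ y ∈ s, ∃ c : k, 0 < c ∧ d = c • (y - x) by
    obtain ⟨x, hx, y, hy, c, hc, rfl⟩ := this
    refine ⟨x, hx, c⁻¹, inv_pos.2 hc, ?_⟩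
    rwa [inv_smul_smul₀ hc.ne', add_sub_cancel]
  induction hd using Submodule.span_induction with
  | mem d hd =>
    obtain ⟨y, hy, x, hx, rfl⟩ := hd
    exact ⟨x, hx, y, hy, 1, one_pos, (one_smul k _).symm⟩
  | zero =>
    obtain ⟨x, hx⟩ := hne
    exact ⟨x, hx, x, hx, 1, one_pos, by simp⟩
  | add d e _ _ hd he =>
    obtain ⟨x, hx, y, hy, a, ha, rfl⟩ := hd
    obtain ⟨x', hx', y', hy', b, hb, rfl⟩ := he
    have hab : a / (a + b) + b / (a + b) = 1 := by field_simp
    refine ⟨_, hs hx hx' (by positivity) (by positivity) hab,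
      _, hs hy hy' (by positivity) (by positivity) hab, a + b, by positivity, ?_⟩
    match_scalars <;> field_simp
  | smul c d _ hd =>
    obtain ⟨x, hx, y, hy, a, ha, rfl⟩ := hd
    rcases lt_trichotomy c 0 with hc | rfl | hc
    · refine ⟨y, hy, x, hx, -c * a, mul_pos (neg_pos.2 hc) ha, ?_⟩
      module
    · exact ⟨x, hx, x, hx, 1, one_pos, by simp⟩
    · exact ⟨x, hx, y, hy, c * a, mul_pos hc ha, (mul_smul c a _).symm⟩

theorem eq_zero_of_sum_eq_zero_of_isLeast [LinearOrder ι] [AddCommMonoid V] {T : Finset ι}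
    {H : ι → Finset ι} (hH : ∀ t ∈ T, IsLeast (H t ∩ T : Set ι) t) {y : ι → V}
    (hy : ∀ i ∉ T, y i = 0) (hsum : ∀ t ∈ T, ∑ i ∈ H t, y i = 0) : y = 0 := by
  classical
  by_contra! hne
  obtain ⟨i, hi⟩ := Function.ne_iff.1 hne
  have hsupport : (T.filter (y · ≠ 0)).Nonempty :=
    ⟨i, Finset.mem_filter.2 ⟨not_imp_comm.1 (hy i) hi, hi⟩⟩
  obtain ⟨t, ht, hmax⟩ := (T.filter (y · ≠ 0)).exists_max_image id hsupport
  rw [Finset.mem_filter] at ht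
  refine ht.2 ?_
  rw [← hsum t ht.1]
  refine (Finset.sum_eq_single_of_mem t (hH t ht.1).1.1 fun j hj hjt => ?_).symm
  by_contra hyj
  have hjT : j ∈ T := not_imp_comm.1 (hy j) hyj
  exact hjt (le_antisymm (hmax j (Finset.mem_filter.2 ⟨hjT, hyj⟩)) ((hH t ht.1).2 ⟨hj, hjT⟩))

end LinearAlgebra

variable {r : ℕ}

/-! ### Exchanges in maximal valid collections -/

theorem not_prec_iff {I I' : Finset (Fin r)} : ¬ Prec I I' ↔ PrecEq I' I := not_lt

theorem Prec.precEq {I I' : Finset (Fin r)} (h : Prec I I') : PrecEq I I' := le_of_lt h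

theorem Prec.ne {I I' : Finset (Fin r)} (h : Prec I I') : I ≠ I' := by
  rintro rfl
  exact lt_irrefl _ h

theorem PrecEq.trans_prec {I I' I'' : Finset (Fin r)} (h : PrecEq I I') (h' : Prec I' I'') :
    Prec I I'' := lt_of_le_of_lt h h'

theorem prec_of_card_lt {I I' : Finset (Fin r)} (h : I.card < I'.card) : Prec I I' :=
  Prod.Lex.toLex_lt_toLex.2 (Or.inl h)

theorem countP_cons_erase {α : Type*} [DecidableEq α] (p : α → Prop) [DecidablePred p]
    {τ : Multiset α} {b : α} (hb : b ∈ τ) (a : α) :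
    (a ::ₘ τ.erase b).countP p + (if p b then 1 else 0) =
      τ.countP p + if p a then 1 else 0 := by
  conv_rhs => rw [← Multiset.cons_erase hb]
  simp only [Multiset.countP_cons]
  ring

theorem countP_subset_add_countP_subset_le {α : Type*} [DecidableEq α] (τ : Multiset (Finset α))
    (S S' : Finset α) :
    τ.countP (· ⊆ S) + τ.countP (· ⊆ S') ≤ τ.countP (· ⊆ S ∩ S') + τ.countP (· ⊆ S ∪ S') := by
  induction τ using Multiset.induction_on with
  | empty => simp
  | cons I τ ih =>
    have hinter : I ⊆ S ∩ S' ↔ I ⊆ S ∧ I ⊆ S' := Finset.subset_inter_iff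
    have hunion : I ⊆ S ∨ I ⊆ S' → I ⊆ S ∪ S' := fun h =>
      h.elim (·.trans Finset.subset_union_left) (·.trans Finset.subset_union_right)
    simp only [Multiset.countP_cons]
    split_ifs <;> lia

theorem isValid_iff {τ : Multiset (Finset (Fin r))} :
    IsValid τ ↔ ∀ S : Finset (Fin r), τ.countP (· ⊆ S) ≤ S.card := by
  constructor
  · intro h S
    rw [Multiset.countP_eq_card_filter]
    refine (h _ (Multiset.filter_le _ _)).trans (Finset.card_le_card ?_)
    exact Multiset.sup_le.2 fun I hI => (Multiset.mem_filter.1 hI).2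
  · intro h s hs
    calc Multiset.card s = s.countP (· ⊆ s.sup) :=
          (Multiset.countP_eq_card.2 fun I hI => Multiset.le_sup hI).symm
      _ ≤ τ.countP (· ⊆ s.sup) := Multiset.countP_le_of_le _ hs
      _ ≤ s.sup.card := h s.sup

/-- A set `S` is tight for a collection `τ` if Hall's condition is an equality for the members of
`τ` contained in `S`. -/
def IsTight (τ : Multiset (Finset (Fin r))) (S : Finset (Fin r)) : Prop :=
  τ.countP (· ⊆ S) = S.card

theorem IsValid.isTight_inter {τ : Multiset (Finset (Fin r))} (hτ : IsValid τ)
    {S S' : Finset (Fin r)} (hS : IsTight τ S) (hS' : IsTight τ S') : IsTight τ (S ∩ S') := by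
  rw [isValid_iff] at hτ
  have hsub := countP_subset_add_countP_subset_le τ S S'
  rw [hS, hS', ← Finset.card_inter_add_card_union] at hsub
  exact le_antisymm (hτ _) (by have := hτ (S ∪ S'); lia)

namespace IsMaximalValid

variable {τ : Multiset (Finset (Fin r))}

theorem isTight_univ (hτ : IsMaximalValid τ) : IsTight τ Finset.univ := by
  have hcount := Multiset.countP_eq_card.2 fun I (_ : I ∈ τ) => Finset.subset_univ I
  rw [IsTight, hcount, hτ.2, Finset.card_univ, Fintype.card_fin]

theorem exists_isLeast_isTight (hτ : IsMaximalValid τ) (I : Finset (Fin r)) :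
    ∃ S, IsLeast {S | I ⊆ S ∧ IsTight τ S} S := by
  classical
  let 𝒮 := Finset.univ.filter fun S => I ⊆ S ∧ IsTight τ S
  refine ⟨𝒮.inf id, ?_, fun S hS => Finset.inf_le (f := id) (Finset.mem_filter.2 ⟨by simp, hS⟩)⟩
  refine Finset.inf_induction (p := fun S => I ⊆ S ∧ IsTight τ S) ?_ ?_ ?_
  · exact ⟨Finset.subset_univ I, hτ.isTight_univ⟩
  · exact fun S hS S' hS' => ⟨Finset.subset_inter hS.1 hS'.1, hτ.1.isTight_inter hS.2 hS'.2⟩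
  · exact fun S hS => (Finset.mem_filter.1 hS).2

theorem cons_erase_iff (hτ : IsMaximalValid τ) {I I' : Finset (Fin r)} :
    IsMaximalValid (I ::ₘ τ.erase I') ↔ I' ∈ τ ∧ ∀ S, I ⊆ S → IsTight τ S → I' ⊆ S := by
  have hvalid := isValid_iff.1 hτ.1
  have hmem : IsMaximalValid (I ::ₘ τ.erase I') → I' ∈ τ := by
    rintro ⟨-, hcard⟩
    by_contra h
    rw [Multiset.erase_of_notMem h, Multiset.card_cons, hτ.2] at hcard
    lia
  refine ⟨fun h => ⟨hmem h, fun S hIS hS => ?_⟩, fun ⟨hI', h⟩ => ⟨isValid_iff.2 fun S => ?_, ?_⟩⟩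
  · by_contra hI'S
    have hcount := countP_cons_erase (· ⊆ S) (hmem h) I
    rw [if_neg hI'S, if_pos hIS, hS] at hcount
    have := isValid_iff.1 h.1 S
    lia
  · have hcount := countP_cons_erase (· ⊆ S) hI' I
    have htight : I ⊆ S → τ.countP (· ⊆ S) = S.card → I' ⊆ S := h S
    have := hvalid S
    split_ifs at hcount <;> lia
  · rw [Multiset.card_cons, Multiset.card_erase_add_one hI', hτ.2]

theorem notMem_EP_iff (hτ : IsMaximalValid τ) {I : Finset (Fin r)} :
    I ∉ EP τ ↔ ∃ S, I ⊆ S ∧ IsTight τ S ∧ ∀ I' ∈ τ, I' ⊆ S → PrecEq I' I := by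
  constructor
  · intro hI
    obtain ⟨S, ⟨hIS, hS⟩, hleast⟩ := hτ.exists_isLeast_isTight I
    refine ⟨S, hIS, hS, fun I' hI' hI'S => not_prec_iff.1 fun hprec => hI ⟨I', hprec, ?_⟩⟩
    exact hτ.cons_erase_iff.2 ⟨hI', fun S' hIS' hS' => hI'S.trans (hleast ⟨hIS', hS'⟩)⟩
  · rintro ⟨S, hIS, hS, hprec⟩ ⟨I', hII', h⟩
    obtain ⟨hI', htight⟩ := hτ.cons_erase_iff.1 h
    exact not_prec_iff.2 (hprec I' hI' (htight S hIS hS)) hII'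

theorem notMem_EP_of_forall_precEq (hτ : IsMaximalValid τ) {I : Finset (Fin r)}
    (h : ∀ I' ∈ τ, PrecEq I' I) : I ∉ EP τ :=
  hτ.notMem_EP_iff.2 ⟨_, Finset.subset_univ I, hτ.isTight_univ, fun I' hI' _ => h I' hI'⟩

end IsMaximalValid

theorem countP_cellType (J : Finset (Fin r) → Finset (Fin (r + 1))) (p : Finset (Fin r) → Prop)
    [DecidablePred p] : (cellType J).countP p = ∑ I with p I, ((J I).card - 1) := by
  rw [cellType, collection, Finset.sum_filter, ← Multiset.coe_countPAddMonoidHom, map_sum]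
  refine Finset.sum_congr rfl fun I _ => ?_
  rw [Multiset.coe_countPAddMonoidHom, ← Multiset.coe_replicate, Multiset.coe_countP,
    List.countP_replicate]
  simp only [decide_eq_true_eq]

theorem card_cellType (J : Finset (Fin r) → Finset (Fin (r + 1))) :
    Multiset.card (cellType J) = ∑ I, ((J I).card - 1) := by
  simp only [cellType, collection, Multiset.card_sum, Multiset.card_replicate]

theorem mem_cellType {J : Finset (Fin r) → Finset (Fin (r + 1))} {I : Finset (Fin r)} :
    I ∈ cellType J ↔ 2 ≤ (J I).card := by
  simp only [cellType, collection, Multiset.mem_sum, Finset.mem_univ, true_and,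
    Multiset.mem_replicate]
  constructor
  · rintro ⟨I', h, rfl⟩
    lia
  · exact fun h => ⟨I, by lia, rfl⟩

theorem isTight_cellType_iff {J : Finset (Fin r) → Finset (Fin (r + 1))} {S : Finset (Fin r)} :
    IsTight (cellType J) S ↔ ∑ I with I ⊆ S, ((J I).card - 1) = S.card := by
  rw [IsTight, countP_cellType]

/-! ### Labels and edge spaces -/

/-- The set of positive labels belonging to `H ⊆ [r]`; compare `withZero`. -/
def labels (H : Finset (Fin r)) : Finset (Fin (r + 1)) := H.map (Fin.succEmb r)

@[simp] theorem succ_mem_labels {H : Finset (Fin r)} {j : Fin r} : j.succ ∈ labels H ↔ j ∈ H := by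
  simp [labels]

@[simp] theorem zero_notMem_labels {H : Finset (Fin r)} : (0 : Fin (r + 1)) ∉ labels H := by
  simp [labels]

theorem mem_labels {H : Finset (Fin r)} {v : Fin (r + 1)} :
    v ∈ labels H ↔ ∃ j ∈ H, j.succ = v := by
  simp [labels]

@[simp] theorem zero_mem_withZero {H : Finset (Fin r)} : (0 : Fin (r + 1)) ∈ withZero H := by
  simp [withZero]

@[simp] theorem succ_mem_withZero {H : Finset (Fin r)} {j : Fin r} :
    j.succ ∈ withZero H ↔ j ∈ H := by
  simp [withZero]

@[simp] theorem withZero_empty : withZero (∅ : Finset (Fin r)) = {0} := rfl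

theorem card_withZero (H : Finset (Fin r)) : (withZero H).card = H.card + 1 := by
  rw [withZero, Finset.card_insert_of_notMem (by simp), Finset.card_map]

theorem withZero_mono {H H' : Finset (Fin r)} (h : H ⊆ H') : withZero H ⊆ withZero H' :=
  Finset.insert_subset_insert _ (Finset.map_subset_map.2 h)

@[simp] theorem vert_zero : vert (0 : Fin (r + 1)) = 0 := rfl

@[simp] theorem vert_succ (j : Fin r) : vert j.succ = Pi.single j (1 : ℝ) := rfl

theorem affineIndependent_vert : AffineIndependent ℝ (vert : Fin (r + 1) → Fin r → ℝ) := by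
  rw [affineIndependent_iff_linearIndependent_vsub ℝ _ 0]
  let pred (v : {v : Fin (r + 1) // v ≠ 0}) : Fin r := v.1.pred v.2
  have hpred : Function.Injective pred := fun _ _ h => Subtype.ext (Fin.pred_inj.1 h)
  have hvert : (fun v : {v : Fin (r + 1) // v ≠ 0} => vert v.1 -ᵥ vert 0) =
      (fun j => Pi.single j (1 : ℝ)) ∘ pred := by
    ext1 v
    rw [vert_zero, vsub_eq_sub, sub_zero, Function.comp_apply, ← vert_succ, Fin.succ_pred]
  rw [hvert]
  exact (Pi.linearIndependent_single_one (Fin r) ℝ).comp pred hpred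

/-- The linear functional `y ↦ ∑_{j ∈ H} y_j`. -/
def coordSum (H : Finset (Fin r)) : (Fin r → ℝ) →ₗ[ℝ] ℝ := ∑ j ∈ H, LinearMap.proj j

theorem coordSum_apply (H : Finset (Fin r)) (y : Fin r → ℝ) : coordSum H y = ∑ j ∈ H, y j := by
  simp [coordSum]

theorem coordSum_single (H : Finset (Fin r)) (j : Fin r) :
    coordSum H (Pi.single j 1) = if j ∈ H then 1 else 0 := by
  simp [coordSum_apply, Pi.single_apply]

theorem coordSum_vert (H : Finset (Fin r)) (v : Fin (r + 1)) :
    coordSum H (vert v) = if v ∈ labels H then 1 else 0 := by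
  induction v using Fin.cases with
  | zero => simp
  | succ j => simp [coordSum_single]

theorem coordSum_ne_zero {H : Finset (Fin r)} (hH : H.Nonempty) : coordSum H ≠ 0 := by
  obtain ⟨j, hj⟩ := hH
  intro h
  simpa [coordSum_single, hj] using congrArg (· (Pi.single j 1)) h

/-- The space spanned by the edge directions of the simplex `Δ_J`. -/
def edgeSpace (J : Finset (Fin (r + 1))) : Submodule ℝ (Fin r → ℝ) :=
  vectorSpan ℝ (vert '' (J : Set (Fin (r + 1))))

theorem edgeSpace_mono {J J' : Finset (Fin (r + 1))} (h : J ⊆ J') : edgeSpace J ≤ edgeSpace J' :=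
  vectorSpan_mono ℝ (Set.image_mono h)

theorem finrank_edgeSpace (J : Finset (Fin (r + 1))) :
    Module.finrank ℝ (edgeSpace J) = J.card - 1 := by
  classical
  rcases J.eq_empty_or_nonempty with rfl | hJ
  · have hbot : edgeSpace (∅ : Finset (Fin (r + 1))) = ⊥ := by
      rw [edgeSpace, Finset.coe_empty, Set.image_empty, vectorSpan_empty]
    rw [hbot, finrank_bot, Finset.card_empty]
  · rw [edgeSpace, ← Finset.coe_image]
    exact affineIndependent_vert.finrank_vectorSpan_image_finset
      (Nat.succ_pred_eq_of_pos hJ.card_pos).symm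

theorem finrank_edgeSpace_withZero (S : Finset (Fin r)) :
    Module.finrank ℝ (edgeSpace (withZero S)) = S.card := by
  rw [finrank_edgeSpace, card_withZero, Nat.add_sub_cancel]

theorem edgeSpace_eq_bot_of_card_le_one {J : Finset (Fin (r + 1))} (hJ : J.card ≤ 1) :
    edgeSpace J = ⊥ := by
  rw [← Submodule.finrank_eq_zero (R := ℝ), finrank_edgeSpace]
  lia

theorem single_mem_edgeSpace_withZero {S : Finset (Fin r)} {j : Fin r} (hj : j ∈ S) :
    Pi.single j 1 ∈ edgeSpace (withZero S) := by
  have h0 : vert 0 ∈ vert '' (withZero S : Set (Fin (r + 1))) := ⟨0, by simp, rfl⟩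
  have hj : vert j.succ ∈ vert '' (withZero S : Set (Fin (r + 1))) := ⟨j.succ, by simpa, rfl⟩
  simpa [edgeSpace] using vsub_mem_vectorSpan ℝ hj h0

theorem edgeSpace_le_ker_coordSum_iff {J : Finset (Fin (r + 1))} {Y : Finset (Fin r)} :
    edgeSpace J ≤ LinearMap.ker (coordSum Y) ↔
      ∀ v ∈ J, ∀ w ∈ J, v ∈ labels Y ↔ w ∈ labels Y := by
  rw [edgeSpace, vectorSpan_def, Submodule.span_le, Set.vsub_subset_iff]
  simp only [Set.forall_mem_image, SetLike.mem_coe, LinearMap.mem_ker, vsub_eq_sub, map_sub,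
    coordSum_vert, sub_eq_zero]
  refine forall₄_congr fun v _ w _ => ?_
  by_cases v ∈ labels Y <;> by_cases w ∈ labels Y <;> simp [*]

theorem apply_eq_zero_of_mem_edgeSpace_withZero {S : Finset (Fin r)} {y : Fin r → ℝ}
    (hy : y ∈ edgeSpace (withZero S)) {j : Fin r} (hj : j ∉ S) : y j = 0 := by
  have hnot : ∀ v ∈ withZero S, v ∉ labels {j} := by
    intro v hv hvj
    obtain ⟨i, hi, rfl⟩ := mem_labels.1 hvj
    rw [Finset.mem_singleton] at hi
    exact hj (hi ▸ succ_mem_withZero.1 hv)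
  have hle : edgeSpace (withZero S) ≤ LinearMap.ker (coordSum {j}) :=
    edgeSpace_le_ker_coordSum_iff.2 fun v hv w hw => iff_of_false (hnot v hv) (hnot w hw)
  simpa [coordSum_apply] using hle hy

/-! ### Minkowski sums of simplices -/

theorem simplex_mono {J J' : Finset (Fin (r + 1))} (h : J ⊆ J') : simplex J ⊆ simplex J' :=
  convexHull_mono (Set.image_mono h)

theorem vert_mem_simplex {J : Finset (Fin (r + 1))} {v : Fin (r + 1)} (h : v ∈ J) :
    vert v ∈ simplex J :=
  subset_convexHull _ _ ⟨v, h, rfl⟩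

theorem vectorSpan_simplex (J : Finset (Fin (r + 1))) : vectorSpan ℝ (simplex J) = edgeSpace J := by
  rw [← direction_affineSpan, simplex, affineSpan_convexHull, direction_affineSpan, edgeSpace]

theorem map_le_of_mem_simplex {J : Finset (Fin (r + 1))} (f : (Fin r → ℝ) →ₗ[ℝ] ℝ) {c : ℝ}
    (h : ∀ v ∈ J, f (vert v) ≤ c) {x : Fin r → ℝ} (hx : x ∈ simplex J) : f x ≤ c :=
  convexHull_min (t := {y | f y ≤ c}) (Set.forall_mem_image.2 h)
    (convex_halfSpace_le f.isLinear c) hx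

theorem map_eq_of_mem_simplex {J : Finset (Fin (r + 1))} (f : (Fin r → ℝ) →ₗ[ℝ] ℝ) {c : ℝ}
    (h : ∀ v ∈ J, f (vert v) = c) {x : Fin r → ℝ} (hx : x ∈ simplex J) : f x = c :=
  convexHull_min (t := {y | f y = c}) (Set.forall_mem_image.2 h) (convex_hyperplane f.isLinear c) hx

variable {l : Finset (Fin r) → ℕ} {J : Finset (Fin r) → Finset (Fin (r + 1))}

theorem mem_minkowskiSum {x : Fin r → ℝ} :
    x ∈ minkowskiSum l J ↔ ∃ g : Finset (Fin r) → (Fin r → ℝ),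
      (∀ I, g I ∈ simplex (J I)) ∧ ∑ I, (l I : ℝ) • g I = x := by
  rw [minkowskiSum, Set.mem_fintype_sum]
  constructor
  · rintro ⟨g, hg, rfl⟩
    choose g' hg' hgg' using fun I => Set.mem_smul_set.1 (hg I)
    exact ⟨g', hg', Finset.sum_congr rfl fun I _ => hgg' I⟩
  · rintro ⟨g, hg, rfl⟩
    exact ⟨_, fun I => Set.smul_mem_smul_set (hg I), rfl⟩

theorem sum_smul_vert_mem_minkowskiSum {w : Finset (Fin r) → Fin (r + 1)} (hw : ∀ I, w I ∈ J I) :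
    ∑ I, (l I : ℝ) • vert (w I) ∈ minkowskiSum l J :=
  mem_minkowskiSum.2 ⟨_, fun I => vert_mem_simplex (hw I), rfl⟩

theorem minkowskiSum_nonempty (h : ∀ I, (J I).Nonempty) : (minkowskiSum l J).Nonempty := by
  choose w hw using h
  exact ⟨_, sum_smul_vert_mem_minkowskiSum hw⟩

theorem minkowskiSum_mono {J' : Finset (Fin r) → Finset (Fin (r + 1))} (h : ∀ I, J I ⊆ J' I) :
    minkowskiSum l J ⊆ minkowskiSum l J' := by
  intro x hx
  obtain ⟨g, hg, rfl⟩ := mem_minkowskiSum.1 hx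
  exact mem_minkowskiSum.2 ⟨g, fun I => simplex_mono (h I) (hg I), rfl⟩

theorem convex_minkowskiSum (l : Finset (Fin r) → ℕ) (J : Finset (Fin r) → Finset (Fin (r + 1))) :
    Convex ℝ (minkowskiSum l J) :=
  convex_sum _ fun _ _ => (convex_convexHull ℝ _).smul _

theorem vectorSpan_minkowskiSum (hne : ∀ I, (J I).Nonempty) (hl : ∀ I, J I ≠ {0} → 0 < l I) :
    vectorSpan ℝ (minkowskiSum l J) = ⨆ I, edgeSpace (J I) := by
  have hsimplex : ∀ I, ((l I : ℝ) • simplex (J I)).Nonempty := fun I =>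
    Set.Nonempty.smul_set ⟨_, vert_mem_simplex (hne I).choose_spec⟩
  have hsmul : ∀ I, vectorSpan ℝ ((l I : ℝ) • simplex (J I)) = edgeSpace (J I) := by
    intro I
    by_cases hI : l I = 0
    · have hJ : J I = {0} := by_contra fun h => (hl I h).ne' hI
      rw [edgeSpace_eq_bot_of_card_le_one (by simp [hJ]), hI, Nat.cast_zero,
        Set.zero_smul_set ⟨_, vert_mem_simplex (hne I).choose_spec⟩, ← Set.singleton_zero,
        vectorSpan_singleton]
    · rw [vectorSpan_smul (Nat.cast_ne_zero.2 hI), vectorSpan_simplex]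
  simp only [minkowskiSum, vectorSpan_sum hsimplex, hsmul, Finset.mem_univ, iSup_pos]

theorem exists_eq_singleton_of_forall_pos (hne : ∀ I, (J I).Nonempty) {i : Fin r}
    (hpos : ∀ x ∈ minkowskiSum l J, 0 < x i) : ∃ I, J I = {i.succ} := by
  by_contra! hJ
  have hother : ∀ I, ∃ v ∈ J I, v ≠ i.succ := fun I => by
    by_contra! h
    exact hJ I ((hne I).subset_singleton_iff.1 fun v hv => Finset.mem_singleton.2 (h v hv))
  choose w hw hwi using hother
  have hvert : ∀ I, vert (w I) i = 0 := fun I => by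
    have h := coordSum_vert {i} (w I)
    rwa [if_neg (by simpa [labels] using hwi I), coordSum_apply, Finset.sum_singleton] at h
  have := hpos _ (sum_smul_vert_mem_minkowskiSum hw)
  simp [hvert] at this

/-! ### The nontrivial boundary -/

/-- The set `S` lies on the hyperplane `x_H = ∑_{I ∩ H ≠ ∅} l_I`, one of those that make up
`OnNontrivialBoundary`. -/
def OnHyperplane (l : Finset (Fin r) → ℕ) (H : Finset (Fin r)) (S : Set (Fin r → ℝ)) : Prop :=
  ∀ x ∈ S, ∑ j ∈ H, x j = ∑ I with (I ∩ H).Nonempty, (l I : ℝ)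

section Boundary

variable {F : Finset (Fin r) → Finset (Fin (r + 1))} {H : Finset (Fin r)} {S : Set (Fin r → ℝ)}

theorem notMem_labels_of_not_nonempty_inter {I : Finset (Fin r)} (hI : ¬ (I ∩ H).Nonempty)
    {v : Fin (r + 1)} (hv : v ∈ withZero I) : v ∉ labels H := by
  intro hvH
  obtain ⟨j, hj, rfl⟩ := mem_labels.1 hvH
  exact hI ⟨j, Finset.mem_inter.2 ⟨succ_mem_withZero.1 hv, hj⟩⟩

theorem coordSum_le_of_mem_simplex_withZero {I : Finset (Fin r)} {y : Fin r → ℝ}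
    (hy : y ∈ simplex (withZero I)) : coordSum H y ≤ if (I ∩ H).Nonempty then 1 else 0 := by
  refine map_le_of_mem_simplex _ (fun v hv => ?_) hy
  rw [coordSum_vert]
  split_ifs with hvH hIH hIH
  · exact le_rfl
  · exact absurd hvH (notMem_labels_of_not_nonempty_inter hIH hv)
  · exact zero_le_one
  · exact le_rfl

theorem sum_filter_eq_sum_mul_boole {ι k : Type*} [NonAssocSemiring k] (s : Finset ι) (p : ι → Prop)
    [DecidablePred p] (f : ι → k) :
    ∑ i ∈ s with p i, f i = ∑ i ∈ s, f i * if p i then 1 else 0 := by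
  simp only [Finset.sum_filter, mul_boole]

theorem coordSum_le_of_mem_transversalhedron {x : Fin r → ℝ} (hx : x ∈ transversalhedron l)
    (H : Finset (Fin r)) : coordSum H x ≤ ∑ I with (I ∩ H).Nonempty, (l I : ℝ) := by
  obtain ⟨g, hg, rfl⟩ := mem_minkowskiSum.1 hx
  simp only [map_sum, map_smul, smul_eq_mul, sum_filter_eq_sum_mul_boole]
  gcongr with I
  exact coordSum_le_of_mem_simplex_withZero (hg I)

theorem onHyperplane_minkowskiSum_iff (hne : ∀ I, (F I).Nonempty)
    (hsub : ∀ I, F I ⊆ withZero I) :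
    OnHyperplane l H (minkowskiSum l F) ↔ ∀ I, 0 < l I → (I ∩ H).Nonempty → F I ⊆ labels H := by
  simp only [OnHyperplane, ← coordSum_apply, sum_filter_eq_sum_mul_boole]
  constructor
  · intro hF I hI hIH v hv
    choose w hw using hne
    have hu : ∀ I', Function.update w I v I' ∈ F I' :=
      (Function.forall_update_iff w fun I' v => v ∈ F I').2 ⟨hv, fun I' _ => hw I'⟩
    have hsum := hF _ (sum_smul_vert_mem_minkowskiSum hu)
    simp only [map_sum, map_smul, smul_eq_mul] at hsum
    have hle : ∀ I' ∈ Finset.univ, (l I' : ℝ) * coordSum H (vert (Function.update w I v I')) ≤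
        l I' * if (I' ∩ H).Nonempty then 1 else 0 := fun I' _ => by
      gcongr
      exact coordSum_le_of_mem_simplex_withZero (vert_mem_simplex (hsub I' (hu I')))
    have hterm := (Finset.sum_eq_sum_iff_of_le hle).1 hsum I (Finset.mem_univ I)
    rw [Function.update_self, coordSum_vert, if_pos hIH,
      mul_right_inj' (Nat.cast_ne_zero.2 hI.ne')] at hterm
    by_contra hvH
    exact zero_ne_one ((if_neg hvH).symm.trans hterm)
  · intro hF x hx
    obtain ⟨g, hg, rfl⟩ := mem_minkowskiSum.1 hx
    simp only [map_sum, map_smul, smul_eq_mul]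
    refine Finset.sum_congr rfl fun I _ => ?_
    rcases (l I).eq_zero_or_pos with hI | hI
    · simp [hI]
    congr 1
    refine map_eq_of_mem_simplex _ (fun v hv => ?_) (hg I)
    rw [coordSum_vert]
    split_ifs with hvH hIH hIH
    · rfl
    · exact absurd hvH (notMem_labels_of_not_nonempty_inter hIH (hsub I hv))
    · exact absurd (hF I hI hIH hv) hvH
    · rfl

theorem onHyperplane_biUnion (hne : ∀ I, (F I).Nonempty) (hsub : ∀ I, F I ⊆ withZero I)
    {T : Finset (Fin r)} {H : Fin r → Finset (Fin r)}
    (hH : ∀ t ∈ T, OnHyperplane l (H t) (minkowskiSum l F)) :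
    OnHyperplane l (T.biUnion H) (minkowskiSum l F) := by
  rw [onHyperplane_minkowskiSum_iff hne hsub]
  rintro I hI ⟨j, hj⟩
  obtain ⟨hjI, t, ht, hjt⟩ := by simpa only [Finset.mem_inter, Finset.mem_biUnion] using hj
  have hF := (onHyperplane_minkowskiSum_iff hne hsub).1 (hH t ht) I hI
    ⟨j, Finset.mem_inter.2 ⟨hjI, hjt⟩⟩
  exact hF.trans (Finset.map_subset_map.2 (Finset.subset_biUnion_of_mem H ht))

namespace OnHyperplane

theorem vectorSpan_le_ker (hS : OnHyperplane l H S) :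
    vectorSpan ℝ S ≤ LinearMap.ker (coordSum H) := by
  rw [vectorSpan_def, Submodule.span_le, Set.vsub_subset_iff]
  intro x hx y hy
  rw [SetLike.mem_coe, LinearMap.mem_ker, vsub_eq_sub, map_sub, coordSum_apply, coordSum_apply,
    hS x hx, hS y hy, sub_self]

theorem vectorSpan_eq_ker (hS : OnHyperplane l H S) (hH : H.Nonempty) (hdim : dim S + 1 = r) :
    vectorSpan ℝ S = LinearMap.ker (coordSum H) := by
  have hker := Module.Dual.finrank_ker_add_one_of_ne_zero (coordSum_ne_zero hH)
  rw [Module.finrank_fin_fun] at hker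
  rw [dim] at hdim
  exact Submodule.eq_of_le_of_finrank_eq hS.vectorSpan_le_ker (by lia)

/-- In a direction `e_j` with `j ∉ H` a facet on the hyperplane of `H` contains a segment; a
direction with `j ∈ H` crosses the supporting hyperplane. -/
theorem freeDirections_eq (hS : OnHyperplane l H S) (hH : H.Nonempty) (hdim : dim S + 1 = r)
    (hconv : Convex ℝ S) (hne : S.Nonempty) (hsub : S ⊆ transversalhedron l) :
    freeDirections l S = H := by
  ext j
  rw [Finset.mem_coe]
  constructor
  · intro hj
    by_contra hjH
    have hmem : Pi.single j 1 ∈ vectorSpan ℝ S := by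
      rw [hS.vectorSpan_eq_ker hH hdim, LinearMap.mem_ker, coordSum_single, if_neg hjH]
    obtain ⟨x, hx, ε, hε, hxε⟩ := exists_pos_smul_mem_of_mem_vectorSpan hconv hne hmem
    exact hj x hx ε hε (hsub hxε)
  · intro hj x hx ε hε hxε
    have hle := coordSum_le_of_mem_transversalhedron hxε H
    rw [map_add, map_smul, coordSum_single, if_pos hj, coordSum_apply, hS x hx, smul_eq_mul] at hle
    linarith

end OnHyperplane

theorem exists_onHyperplane_of_mem_faceLabel {𝒟 : Set (Finset (Fin r) → Finset (Fin (r + 1)))}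
    (h𝒟 : ∀ J ∈ 𝒟, ∀ I, J I ⊆ withZero I) {I₀ : Finset (Fin r)} {t : Fin r}
    (ht : t ∈ faceLabel l 𝒟 I₀ F) :
    ∃ H, OnHyperplane l H (minkowskiSum l F) ∧ IsLeast (H ∩ I₀ : Set (Fin r)) t := by
  obtain ⟨K, ⟨J, hJ, hKJ⟩, hdim, ⟨H, hH, hK⟩, hFK, hleast⟩ := ht
  have hfree := OnHyperplane.freeDirections_eq hK hH hdim (convex_minkowskiSum l K)
    (minkowskiSum_nonempty fun I => (hKJ I).1)
    (minkowskiSum_mono fun I => (hKJ I).2.trans (h𝒟 J hJ I))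
  exact ⟨H, fun x hx => hK x (hFK hx), hfree ▸ hleast⟩

end Boundary

/-! ### Fine cells -/

/-- The family `J` describes a full-dimensional fine cell: its summands satisfy
`J I ⊆ {0} ∪ I`, and the sum of their edge spaces, whose dimensions add up to `r`, is `ℝ^r`. In
particular this sum is direct. -/
structure IsFineCell (J : Finset (Fin r) → Finset (Fin (r + 1))) : Prop where
  nonempty : ∀ I, (J I).Nonempty
  subset_withZero : ∀ I, J I ⊆ withZero I
  sum_card : ∑ I, ((J I).card - 1) = r
  iSup_edgeSpace : ⨆ I, edgeSpace (J I) = ⊤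

theorem iSup_edgeSpace_le_of_subset_withZero {F : Finset (Fin r) → Finset (Fin (r + 1))}
    (hF : ∀ I, F I ⊆ withZero I) (S : Finset (Fin r)) :
    ⨆ I ∈ Finset.univ.filter (· ⊆ S), edgeSpace (F I) ≤ edgeSpace (withZero S) :=
  iSup₂_le fun I hI => edgeSpace_mono ((hF I).trans (withZero_mono (Finset.mem_filter.1 hI).2))

namespace IsFineCell

variable {F : Finset (Fin r) → Finset (Fin (r + 1))} {S : Finset (Fin r)}

theorem iSupIndep_edgeSpace (hJ : IsFineCell J) : iSupIndep fun I => edgeSpace (J I) := by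
  rw [iSupIndep_iff_finrank_iSup, hJ.iSup_edgeSpace, finrank_top, Module.finrank_fin_fun]
  simp only [finrank_edgeSpace, hJ.sum_card]

theorem finrank_iSup_edgeSpace_face (hJ : IsFineCell J) (hF : ∀ I, F I ⊆ J I)
    (D : Finset (Finset (Fin r))) :
    Module.finrank ℝ ↥(⨆ I ∈ D, edgeSpace (F I)) = ∑ I ∈ D, ((F I).card - 1) := by
  have hind := hJ.iSupIndep_edgeSpace.mono fun I => edgeSpace_mono (hF I)
  simp only [finrank_biSup_of_iSupIndep hind, finrank_edgeSpace]

theorem sum_card_le (hJ : IsFineCell J) (S : Finset (Fin r)) :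
    ∑ I with I ⊆ S, ((J I).card - 1) ≤ S.card := by
  rw [← hJ.finrank_iSup_edgeSpace_face fun I => subset_rfl, ← finrank_edgeSpace_withZero S]
  exact Submodule.finrank_mono (iSup_edgeSpace_le_of_subset_withZero hJ.subset_withZero S)

theorem isMaximalValid_cellType (hJ : IsFineCell J) : IsMaximalValid (cellType J) :=
  ⟨isValid_iff.2 fun S => (countP_cellType J _).trans_le (hJ.sum_card_le S),
    (card_cellType J).trans hJ.sum_card⟩

theorem iSup_edgeSpace_eq_of_isTight (hJ : IsFineCell J) (hS : IsTight (cellType J) S) :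
    ⨆ I ∈ Finset.univ.filter (· ⊆ S), edgeSpace (J I) = edgeSpace (withZero S) :=
  Submodule.eq_of_le_of_finrank_eq (iSup_edgeSpace_le_of_subset_withZero hJ.subset_withZero S) <| by
    rw [hJ.finrank_iSup_edgeSpace_face fun I => subset_rfl, finrank_edgeSpace_withZero,
      isTight_cellType_iff.1 hS]

end IsFineCell

/-! ### Extension across a saturated face -/

/-- The face `F` of the fine cell `J` can be extended by a simplex `Δ_{{0} ∪ T}` of complementary
dimension: its direction space is complementary to the coordinate space of `T`. Moreover, it lies
on the hyperplane of a single set `U ⊇ T`, the union of the sets `H` of the hyperplanes that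
produce the labels `t ∈ T`. -/
structure IsExtensionFace (l : Finset (Fin r) → ℕ) (J F : Finset (Fin r) → Finset (Fin (r + 1)))
    (T U : Finset (Fin r)) : Prop where
  isFineCell : IsFineCell J
  pos_of_ne : ∀ I, J I ≠ {0} → 0 < l I
  nonempty : ∀ I, (F I).Nonempty
  subset : ∀ I, F I ⊆ J I
  label_subset : T ⊆ U
  onHyperplane : OnHyperplane l U (minkowskiSum l F)
  disjoint : Disjoint (⨆ I, edgeSpace (F I)) (edgeSpace (withZero T))
  finrank_add_card : Module.finrank ℝ ↥(⨆ I, edgeSpace (F I)) + T.card = r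

theorem ne_singleton_of_face {s t : Finset (Fin (r + 1))} (hs : s.Nonempty) (hst : s ⊆ t)
    {v : Fin (r + 1)} (h : s ≠ {v}) : t ≠ {v} := by
  rintro rfl
  exact h (hs.subset_singleton_iff.1 hst)

theorem disjoint_edgeSpace_withZero_of_isLeast {W : Submodule ℝ (Fin r → ℝ)} {T : Finset (Fin r)}
    {H : Fin r → Finset (Fin r)} (hH : ∀ t ∈ T, IsLeast (H t ∩ T : Set (Fin r)) t)
    (hW : ∀ t ∈ T, W ≤ LinearMap.ker (coordSum (H t))) : Disjoint W (edgeSpace (withZero T)) :=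
  Submodule.disjoint_def.2 fun y hyW hyT =>
    eq_zero_of_sum_eq_zero_of_isLeast hH (fun _ => apply_eq_zero_of_mem_edgeSpace_withZero hyT)
      fun t ht => (coordSum_apply (H t) y).symm.trans (hW t ht hyW)

theorem IsSaturated.exists_isExtensionFace {𝒟 : Set (Finset (Fin r) → Finset (Fin (r + 1)))}
    (h𝒟 : ∀ J ∈ 𝒟, IsFineCell J ∧ ∀ I, J I ≠ {0} → 0 < l I) {I₀ T : Finset (Fin r)}
    {F : Finset (Fin r) → Finset (Fin (r + 1))} (hF : IsSaturated l 𝒟 I₀ F T) :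
    T ⊆ I₀ ∧ ∃ J ∈ 𝒟, ∃ U, IsExtensionFace l J F T U := by
  obtain ⟨⟨J, hJ, hFJ⟩, -, hT, hdim⟩ := hF
  obtain ⟨hfine, hpos⟩ := h𝒟 J hJ
  have hlabel : ∀ t ∈ T, ∃ H : Finset (Fin r), OnHyperplane l H (minkowskiSum l F) ∧
      IsLeast (H ∩ I₀ : Set (Fin r)) t := fun t ht =>
    exists_onHyperplane_of_mem_faceLabel (fun J hJ => (h𝒟 J hJ).1.subset_withZero)
      (hT ▸ Finset.mem_coe.2 ht)
  choose! H hH hleast using hlabel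
  have hTI₀ : T ⊆ I₀ := fun t ht => (hleast t ht).1.2
  have hspan : vectorSpan ℝ (minkowskiSum l F) = ⨆ I, edgeSpace (F I) :=
    vectorSpan_minkowskiSum (fun I => (hFJ I).1) fun I hI =>
      hpos I (ne_singleton_of_face (hFJ I).1 (hFJ I).2 hI)
  refine ⟨hTI₀, J, hJ, T.biUnion H, hfine, hpos, fun I => (hFJ I).1, fun I => (hFJ I).2, ?_, ?_, ?_,
    hspan ▸ hdim⟩
  · exact fun t ht => Finset.mem_biUnion.2 ⟨t, ht, (hleast t ht).1.1⟩
  · exact onHyperplane_biUnion (fun I => (hFJ I).1)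
      (fun I => (hFJ I).2.trans (hfine.subset_withZero I)) hH
  · exact disjoint_edgeSpace_withZero_of_isLeast
      (fun t ht => ⟨⟨(hleast t ht).1.1, ht⟩, fun j hj => (hleast t ht).2 ⟨hj.1, hTI₀ hj.2⟩⟩)
      fun t ht => hspan ▸ (hH t ht).vectorSpan_le_ker

namespace IsExtensionFace

variable {F : Finset (Fin r) → Finset (Fin (r + 1))} {T U : Finset (Fin r)}

theorem subset_withZero (h : IsExtensionFace l J F T U) (I : Finset (Fin r)) : F I ⊆ withZero I :=
  (h.subset I).trans (h.isFineCell.subset_withZero I)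

theorem pos_of_face_ne (h : IsExtensionFace l J F T U) {I : Finset (Fin r)} (hI : F I ≠ {0}) :
    0 < l I :=
  h.pos_of_ne I (ne_singleton_of_face (h.nonempty I) (h.subset I) hI)

theorem eq_singleton_of_eq_zero (h : IsExtensionFace l J F T U) {I : Finset (Fin r)}
    (hI : l I = 0) : F I = {0} :=
  by_contra fun hne => (h.pos_of_face_ne hne).ne' hI

theorem subset_labels (h : IsExtensionFace l J F T U) {I : Finset (Fin r)} (hI : 0 < l I)
    (hIU : ¬ I ⊆ Uᶜ) : F I ⊆ labels U :=
  (onHyperplane_minkowskiSum_iff h.nonempty h.subset_withZero).1 h.onHyperplane I hI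
    (by rwa [Finset.subset_compl_iff_disjoint_right, Finset.not_disjoint_iff_nonempty_inter] at hIU)

theorem edgeSpace_le_ker (h : IsExtensionFace l J F T U) (I : Finset (Fin r)) :
    edgeSpace (F I) ≤ LinearMap.ker (coordSum U) :=
  calc edgeSpace (F I) ≤ ⨆ I, edgeSpace (F I) := le_iSup (fun I => edgeSpace (F I)) I
    _ = vectorSpan ℝ (minkowskiSum l F) :=
      (vectorSpan_minkowskiSum h.nonempty fun _ => h.pos_of_face_ne).symm
    _ ≤ LinearMap.ker (coordSum U) := h.onHyperplane.vectorSpan_le_ker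

theorem sum_card_add_card (h : IsExtensionFace l J F T U) :
    ∑ I, ((F I).card - 1) + T.card = r := by
  have hind := h.isFineCell.iSupIndep_edgeSpace.mono fun I => edgeSpace_mono (h.subset I)
  have hrank := (iSupIndep_iff_finrank_iSup _).1 hind
  simp only [finrank_edgeSpace] at hrank
  rw [← hrank, h.finrank_add_card]

theorem sup_edgeSpace_withZero_eq_top (h : IsExtensionFace l J F T U) :
    (⨆ I, edgeSpace (F I)) ⊔ edgeSpace (withZero T) = ⊤ := by
  refine Submodule.eq_top_of_disjoint _ _ ?_ h.disjoint
  rw [finrank_edgeSpace_withZero, h.finrank_add_card, Module.finrank_fin_fun]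

theorem isFineCell_update (h : IsExtensionFace l J F T U) {I₀ : Finset (Fin r)} (hI₀ : l I₀ = 0)
    (hT : T ⊆ I₀) : IsFineCell (Function.update F I₀ (withZero T)) := by
  have hFI₀ := h.eq_singleton_of_eq_zero hI₀
  refine ⟨?_, ?_, ?_, ?_⟩
  · exact (Function.forall_update_iff F fun _ s => s.Nonempty).2
      ⟨⟨0, zero_mem_withZero⟩, fun I _ => h.nonempty I⟩
  · exact (Function.forall_update_iff F fun I s => s ⊆ withZero I).2
      ⟨withZero_mono hT, fun I _ => h.subset_withZero I⟩
  · have hF := h.sum_card_add_card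
    rw [← Finset.add_sum_erase _ _ (Finset.mem_univ I₀), hFI₀] at hF
    rw [← Finset.add_sum_erase _ _ (Finset.mem_univ I₀), Function.update_self, card_withZero,
      Finset.sum_congr rfl fun I hI => by rw [Function.update_of_ne (Finset.ne_of_mem_erase hI)]]
    simp only [Finset.card_singleton, tsub_self, zero_add] at hF
    lia
  · rw [eq_top_iff, ← h.sup_edgeSpace_withZero_eq_top]
    refine sup_le (iSup_le fun I => ?_) (le_iSup_of_le I₀ (by rw [Function.update_self]))
    by_cases hI : I = I₀
    · rw [hI, hFI₀, edgeSpace_eq_bot_of_card_le_one (by simp)]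
      exact bot_le
    · exact le_iSup_of_le I (by rw [Function.update_of_ne hI])

/-- The edge spaces of the summands `F I` with `I ⊈ Uᶜ` lie in the coordinate space of `U` and
meet that of `T ⊆ U` only in `0`. -/
theorem sum_card_not_subset_compl_add_card_le (h : IsExtensionFace l J F T U) :
    ∑ I with ¬ I ⊆ Uᶜ, ((F I).card - 1) + T.card ≤ U.card := by
  rw [← h.isFineCell.finrank_iSup_edgeSpace_face h.subset, ← finrank_edgeSpace_withZero T,
    ← finrank_edgeSpace_withZero U]
  have hle : ⨆ I ∈ Finset.univ.filter (¬ · ⊆ Uᶜ), edgeSpace (F I) ≤ ⨆ I, edgeSpace (F I) :=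
    iSup_mono fun I => iSup_le fun _ => le_rfl
  rw [← Submodule.finrank_sup_add_finrank_inf_eq, (h.disjoint.mono_left hle).eq_bot, finrank_bot,
    add_zero]
  refine Submodule.finrank_mono (sup_le (iSup₂_le fun I hI => ?_)
    (edgeSpace_mono (withZero_mono h.label_subset)))
  by_cases hF : F I = {0}
  · rw [hF]
    exact edgeSpace_mono (Finset.singleton_subset_iff.2 zero_mem_withZero)
  · exact edgeSpace_mono ((h.subset_labels (h.pos_of_face_ne hF) (Finset.mem_filter.1 hI).2).trans
      (Finset.subset_insert _ _))

/-- All inequalities in `r = dim F + |T| ≤ |Uᶜ| + |U| = r` are equalities. -/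
theorem sum_card_subset_compl (h : IsExtensionFace l J F T U) :
    ∑ I with I ⊆ Uᶜ, ((F I).card - 1) = Uᶜ.card := by
  refine le_antisymm ((Finset.sum_le_sum fun I _ => ?_).trans (h.isFineCell.sum_card_le Uᶜ)) ?_
  · gcongr
    exact h.subset I
  · have hsum := h.sum_card_add_card
    rw [← Finset.sum_filter_add_sum_filter_not _ (· ⊆ Uᶜ)] at hsum
    have hU := U.card_add_card_compl
    rw [Fintype.card_fin] at hU
    have := h.sum_card_not_subset_compl_add_card_le
    lia

theorem isTight_compl (h : IsExtensionFace l J F T U) : IsTight (cellType J) Uᶜ := by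
  refine isTight_cellType_iff.2 (le_antisymm (h.isFineCell.sum_card_le Uᶜ) ?_)
  rw [← h.sum_card_subset_compl]
  gcongr with I
  exact h.subset I

theorem eq_of_subset_compl (h : IsExtensionFace l J F T U) {I : Finset (Fin r)} (hI : I ⊆ Uᶜ) :
    F I = J I := by
  have hle : ∀ I ∈ Finset.univ.filter (· ⊆ Uᶜ), (F I).card - 1 ≤ (J I).card - 1 := fun I _ => by
    gcongr
    exact h.subset I
  have heq := (Finset.sum_eq_sum_iff_of_le hle).1
    (h.sum_card_subset_compl.trans (isTight_cellType_iff.1 h.isTight_compl).symm) I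
    (Finset.mem_filter.2 ⟨Finset.mem_univ I, hI⟩)
  refine Finset.eq_of_subset_of_card_le (h.subset I) ?_
  have := (h.nonempty I).card_pos
  lia

end IsExtensionFace

/-! ### The invariant of the extension steps -/

/-- The functional `∑_{j ∈ Y} x_j` certifies that `J I` does not contain `0`: it is `1` on the
vertices of `Δ_{J I}` and constant on the summands of all types up to `I`. -/
def IsSeparating (J : Finset (Fin r) → Finset (Fin (r + 1))) (I Y : Finset (Fin r)) : Prop :=
  J I ⊆ labels Y ∧ ∀ I', PrecEq I' I → edgeSpace (J I') ≤ LinearMap.ker (coordSum Y)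

/-- The invariant of the extension steps: a fine cell, with trivial summands for the types that do
not occur, that satisfies the claimed equivalence for the occurring types. A separating functional
is required instead of `I ∈ EP (cellType J)` because it survives the passage to a face. -/
structure IsAdmissibleCell (l : Finset (Fin r) → ℕ) (J : Finset (Fin r) → Finset (Fin (r + 1))) :
    Prop extends IsFineCell J where
  pos_of_ne : ∀ I, J I ≠ {0} → 0 < l I
  succ_mem : ∀ j, j.succ ∈ J {j}
  exists_isSeparating : ∀ I, 0 ∉ J I → ∃ Y, IsSeparating J I Y
  notMem_EP : ∀ I, 0 < l I → 0 ∈ J I → I ∉ EP (cellType J)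

theorem IsSeparating.not_subset_of_isTight {I Y S : Finset (Fin r)} (hY : IsSeparating J I Y)
    (hJ : IsFineCell J) (hS : IsTight (cellType J) S)
    (hprec : ∀ I' ∈ cellType J, I' ⊆ S → PrecEq I' I) : ¬ I ⊆ S := by
  intro hIS
  have hker : edgeSpace (withZero S) ≤ LinearMap.ker (coordSum Y) := by
    rw [← hJ.iSup_edgeSpace_eq_of_isTight hS]
    refine iSup₂_le fun I' hI' => ?_
    by_cases hcard : (J I').card ≤ 1
    · exact (edgeSpace_eq_bot_of_card_le_one hcard).trans_le bot_le
    · exact hY.2 I' (hprec I' (mem_cellType.2 (by lia)) (Finset.mem_filter.1 hI').2)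
  obtain ⟨v, hv⟩ := hJ.nonempty I
  obtain ⟨j, hjY, rfl⟩ := mem_labels.1 (hY.1 hv)
  have hjS : j ∈ S := hIS (succ_mem_withZero.1 (hJ.subset_withZero I hv))
  have hzero : coordSum Y (Pi.single j 1) = 0 := hker (single_mem_edgeSpace_withZero hjS)
  rw [coordSum_single, if_pos hjY] at hzero
  exact one_ne_zero hzero

theorem IsAdmissibleCell.zero_notMem_iff (hJ : IsAdmissibleCell l J) {I : Finset (Fin r)}
    (hI : 0 < l I) : 0 ∉ J I ↔ I ∈ EP (cellType J) := by
  refine ⟨fun h0 => ?_, fun hEP h0 => hJ.notMem_EP I hI h0 hEP⟩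
  by_contra hEP
  obtain ⟨S, hIS, hS, hprec⟩ := hJ.isMaximalValid_cellType.notMem_EP_iff.1 hEP
  obtain ⟨Y, hY⟩ := hJ.exists_isSeparating I h0
  exact hY.not_subset_of_isTight hJ.toIsFineCell hS hprec hIS

namespace IsExtensionFace

variable {F : Finset (Fin r) → Finset (Fin (r + 1))} {I₀ I T U : Finset (Fin r)}

theorem succ_mem (h : IsExtensionFace l J F T U) {j : Fin r} (hl : 0 < l {j})
    (hj : j.succ ∈ J {j}) : j.succ ∈ F {j} := by
  by_cases hjU : {j} ⊆ Uᶜ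
  · rwa [h.eq_of_subset_compl hjU]
  · obtain ⟨v, hv⟩ := h.nonempty {j}
    obtain ⟨i, -, rfl⟩ := mem_labels.1 (h.subset_labels hl hjU hv)
    have hij : i = j := Finset.mem_singleton.1 (succ_mem_withZero.1 (h.subset_withZero {j} hv))
    exact hij ▸ hv

theorem exists_isSeparating (h : IsExtensionFace l J F T U)
    (hJ : 0 ∉ J I → ∃ Y, IsSeparating J I Y) (hI : 0 ∉ F I) : ∃ Y, IsSeparating F I Y := by
  by_cases h0 : 0 ∈ J I
  · have hpos : 0 < l I := h.pos_of_face_ne fun hF => hI (by simp [hF])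
    have hIU : ¬ I ⊆ Uᶜ := fun hIU => hI (h.eq_of_subset_compl hIU ▸ h0)
    exact ⟨U, h.subset_labels hpos hIU, fun I' _ => h.edgeSpace_le_ker I'⟩
  · obtain ⟨Y, hY, hker⟩ := hJ h0
    exact ⟨Y, (h.subset I).trans hY, fun I' hI' =>
      (edgeSpace_mono (h.subset I')).trans (hker I' hI')⟩

theorem update_eq_of_subset_compl (h : IsExtensionFace l J F T U) (hI₀ : l I₀ = 0) (hT : T ⊆ I₀)
    (hI : I ⊆ Uᶜ) : Function.update F I₀ (withZero T) I = J I := by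
  rw [← h.eq_of_subset_compl hI]
  by_cases hne : I = I₀
  · subst hne
    have hTempty : T = ∅ := disjoint_self.1 <|
      (Finset.subset_compl_iff_disjoint_right.1 (hT.trans hI)).mono_right h.label_subset
    rw [Function.update_self, hTempty, withZero_empty, h.eq_singleton_of_eq_zero hI₀]
  · rw [Function.update_of_ne hne]

theorem notMem_EP_cellType_update (h : IsExtensionFace l J F T U) (hI₀ : l I₀ = 0) (hT : T ⊆ I₀)
    (hI : 0 < l I) (h0 : 0 ∈ F I) (hEP : I ∉ EP (cellType J)) :
    I ∉ EP (cellType (Function.update F I₀ (withZero T))) := by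
  have hmax := h.isFineCell.isMaximalValid_cellType
  have hIU : I ⊆ Uᶜ := by_contra fun hIU => zero_notMem_labels (h.subset_labels hI hIU h0)
  obtain ⟨S, hIS, hS, hprec⟩ := hmax.notMem_EP_iff.1 hEP
  have hJ : ∀ I' ⊆ S ∩ Uᶜ, Function.update F I₀ (withZero T) I' = J I' := fun I' hI' =>
    h.update_eq_of_subset_compl hI₀ hT (hI'.trans Finset.inter_subset_right)
  refine (h.isFineCell_update hI₀ hT).isMaximalValid_cellType.notMem_EP_iff.2
    ⟨S ∩ Uᶜ, Finset.subset_inter hIS hIU, ?_, fun I' hmem hI' => ?_⟩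
  · rw [isTight_cellType_iff,
      ← isTight_cellType_iff.1 (hmax.1.isTight_inter hS h.isTight_compl)]
    exact Finset.sum_congr rfl fun I' hI' => by rw [hJ I' (Finset.mem_filter.1 hI').2]
  · rw [mem_cellType, hJ I' hI', ← mem_cellType] at hmem
    exact hprec I' hmem (hI'.trans Finset.inter_subset_left)

end IsExtensionFace

theorem before_pos_iff {I₀ I : Finset (Fin r)} : 0 < before l I₀ I ↔ Prec I I₀ ∧ 0 < l I := by
  rw [before]
  split_ifs with h <;> simp [h]

theorem before_self (l : Finset (Fin r) → ℕ) (I₀ : Finset (Fin r)) : before l I₀ I₀ = 0 :=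
  if_neg (lt_irrefl _)

section Extension

variable {F : Finset (Fin r) → Finset (Fin (r + 1))} {I₀ T U : Finset (Fin r)}

theorem IsExtensionFace.precEq_of_update_ne (h : IsExtensionFace (before l I₀) J F T U)
    {I : Finset (Fin r)} (hI : Function.update F I₀ (withZero T) I ≠ {0}) : PrecEq I I₀ := by
  by_cases hne : I = I₀
  · exact hne ▸ le_rfl
  · rw [Function.update_of_ne hne] at hI
    exact (before_pos_iff.1 (h.pos_of_face_ne hI)).1.precEq

theorem IsAdmissibleCell.update (hJ : IsAdmissibleCell l J) (hl : ∀ j, 0 < l {j})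
    (hcard : 2 ≤ I₀.card) (hl₀ : 0 < l I₀) (hT : T ⊆ I₀)
    (h : IsExtensionFace (before l I₀) J F T U) :
    IsAdmissibleCell l (Function.update F I₀ (withZero T)) := by
  have hfine := h.isFineCell_update (before_self l I₀) hT
  refine ⟨hfine, fun I => ?_, fun j => ?_, fun I h0 => ?_, fun I hI h0 => ?_⟩
  · exact (Function.forall_update_iff F fun I s => s ≠ {0} → 0 < l I).2
      ⟨fun _ => hl₀, fun I _ hF => (before_pos_iff.1 (h.pos_of_face_ne hF)).2⟩ I
  · have hj : Prec {j} I₀ := prec_of_card_lt (by rwa [Finset.card_singleton])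
    rw [Function.update_of_ne hj.ne]
    exact h.succ_mem (before_pos_iff.2 ⟨hj, hl j⟩) (hJ.succ_mem j)
  · have hne : I ≠ I₀ := fun hne => h0 (by simp [hne])
    rw [Function.update_of_ne hne] at h0
    have hI : Prec I I₀ := (before_pos_iff.1 (h.pos_of_face_ne fun hF => h0 (by simp [hF]))).1
    obtain ⟨Y, hY, hker⟩ := h.exists_isSeparating (hJ.exists_isSeparating I) h0
    refine ⟨Y, by rwa [Function.update_of_ne hne], fun I' hI' => ?_⟩
    rw [Function.update_of_ne (hI'.trans_prec hI).ne]
    exact hker I' hI'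
  · by_cases hII₀ : Prec I I₀
    · rw [Function.update_of_ne hII₀.ne] at h0
      exact h.notMem_EP_cellType_update (before_self l I₀) hT (before_pos_iff.2 ⟨hII₀, hI⟩) h0
        (hJ.notMem_EP I hI (h.subset I h0))
    · refine hfine.isMaximalValid_cellType.notMem_EP_of_forall_precEq fun I' hI' => ?_
      refine (h.precEq_of_update_ne fun hzero => ?_).trans (not_prec_iff.1 hII₀)
      rw [mem_cellType, hzero, Finset.card_singleton] at hI'
      lia

theorem isAdmissibleCell_of_mem_extend {𝒟 : Set (Finset (Fin r) → Finset (Fin (r + 1)))}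
    (h𝒟 : ∀ J ∈ 𝒟, IsAdmissibleCell l J ∧ ∀ I, J I ≠ {0} → Prec I I₀) (hl : ∀ j, 0 < l {j})
    (hcard : 2 ≤ I₀.card) (hl₀ : 0 < l I₀) (hJ : J ∈ extend l 𝒟 I₀) :
    IsAdmissibleCell l J ∧ ∀ I, J I ≠ {0} → PrecEq I I₀ := by
  obtain hJ | ⟨F, T, hF, rfl⟩ := hJ
  · exact ⟨(h𝒟 J hJ).1, fun I hI => ((h𝒟 J hJ).2 I hI).precEq⟩
  · obtain ⟨hT, J, hJ, U, h⟩ := hF.exists_isExtensionFace fun J hJ => ⟨(h𝒟 J hJ).1.toIsFineCell,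
      fun I hI => before_pos_iff.2 ⟨(h𝒟 J hJ).2 I hI, (h𝒟 J hJ).1.pos_of_ne I hI⟩⟩
    exact ⟨(h𝒟 J hJ).1.update hl hcard hl₀ hT h, fun I => h.precEq_of_update_ne⟩

end Extension

/-! ### The cells of the canonical subdivision -/

theorem zero_mem_initialCell (I : Finset (Fin r)) : 0 ∈ initialCell I := by
  unfold initialCell
  split_ifs <;> simp

theorem card_initialCell (I : Finset (Fin r)) :
    (initialCell I).card = if I.card = 1 then 2 else 1 := by
  unfold initialCell
  split_ifs with hle hone hone
  · rw [card_withZero, hone]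
  · rw [card_withZero]
    lia
  · lia
  · rfl

theorem card_eq_one_of_initialCell_ne {I : Finset (Fin r)} (hI : initialCell I ≠ {0}) :
    I.card = 1 := by
  by_contra hcard
  obtain ⟨v, hv⟩ := Finset.card_eq_one.1 ((card_initialCell I).trans (if_neg hcard))
  have h0 := zero_mem_initialCell I
  rw [hv, Finset.mem_singleton] at h0
  exact hI (h0 ▸ hv)

theorem mem_cellType_initialCell {I : Finset (Fin r)} :
    I ∈ cellType initialCell ↔ I.card = 1 := by
  rw [mem_cellType, card_initialCell]
  split_ifs with h <;> simp [h]

theorem sum_card_initialCell (S : Finset (Fin r)) :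
    ∑ I with I ⊆ S, ((initialCell I).card - 1) = S.card := by
  have hcard : ∀ I : Finset (Fin r), (initialCell I).card - 1 = if I.card = 1 then 1 else 0 :=
    fun I => by rw [card_initialCell]; split_ifs <;> rfl
  have hfilter : {I ∈ Finset.univ.filter (· ⊆ S) | I.card = 1} = S.powersetCard 1 := by
    ext I
    simp
  simp only [hcard, Finset.sum_boole, hfilter, Finset.card_powersetCard, Nat.choose_one_right,
    Nat.cast_id]

theorem isFineCell_initialCell : IsFineCell (initialCell (r := r)) := by
  refine ⟨fun I => ⟨0, zero_mem_initialCell I⟩, fun I => ?_, ?_, ?_⟩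
  · unfold initialCell
    split_ifs <;> simp
  · simpa using sum_card_initialCell (Finset.univ : Finset (Fin r))
  · rw [eq_top_iff, ← (Pi.basisFun ℝ (Fin r)).span_eq, Submodule.span_le]
    rintro _ ⟨j, rfl⟩
    rw [Pi.basisFun_apply]
    exact Submodule.mem_iSup_of_mem {j}
      (single_mem_edgeSpace_withZero (S := {j}) (Finset.mem_singleton_self j))

theorem notMem_EP_cellType_initialCell (I : Finset (Fin r)) : I ∉ EP (cellType initialCell) := by
  have hmax := (isFineCell_initialCell (r := r)).isMaximalValid_cellType
  by_cases hcard : I.card ≤ 1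
  · refine hmax.notMem_EP_iff.2
      ⟨I, subset_rfl, isTight_cellType_iff.2 (sum_card_initialCell I), fun I' hI' hsub => ?_⟩
    rw [mem_cellType_initialCell] at hI'
    exact (Finset.eq_of_subset_of_card_le hsub (by lia)) ▸ le_rfl
  · refine hmax.notMem_EP_of_forall_precEq fun I' hI' => (prec_of_card_lt ?_).precEq
    rw [mem_cellType_initialCell] at hI'
    lia

theorem isAdmissibleCell_initialCell (hl : ∀ j, 0 < l {j}) : IsAdmissibleCell l initialCell := by
  refine ⟨isFineCell_initialCell, fun I hI => ?_, fun j => by simp [initialCell],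
    fun I h0 => absurd (zero_mem_initialCell I) h0, fun I _ _ => notMem_EP_cellType_initialCell I⟩
  obtain ⟨j, rfl⟩ := Finset.card_eq_one.1 (card_eq_one_of_initialCell_ne hI)
  exact hl j

theorem isAdmissibleCell_of_mem_foldl_extend (hl : ∀ j, 0 < l {j}) {L : List (Finset (Fin r))}
    (hsorted : L.Pairwise Prec) (hL : ∀ I₀ ∈ L, 2 ≤ I₀.card ∧ 0 < l I₀)
    {𝒟 : Set (Finset (Fin r) → Finset (Fin (r + 1)))}
    (h𝒟 : ∀ J ∈ 𝒟, IsAdmissibleCell l J ∧ ∀ I₀ ∈ L, ∀ I, J I ≠ {0} → Prec I I₀)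
    (hJ : J ∈ L.foldl (extend l) 𝒟) : IsAdmissibleCell l J := by
  induction L generalizing 𝒟 with
  | nil => exact (h𝒟 J hJ).1
  | cons I₀ L ih =>
    obtain ⟨hI₀, hsorted⟩ := List.pairwise_cons.1 hsorted
    obtain ⟨⟨hcard, hl₀⟩, hL⟩ := List.forall_mem_cons.1 hL
    refine ih hsorted hL (fun J' hJ' => ?_) hJ
    obtain ⟨hadm, hprec⟩ := isAdmissibleCell_of_mem_extend
      (fun J hJ => ⟨(h𝒟 J hJ).1, (h𝒟 J hJ).2 I₀ List.mem_cons_self⟩) hl hcard hl₀ hJ'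
    exact ⟨hadm, fun I₁ hI₁ I hI => (hprec I hI).trans_prec (hI₀ I₁ hI₁)⟩

theorem mem_laterTypes {I : Finset (Fin r)} : I ∈ laterTypes l ↔ 2 ≤ I.card ∧ 0 < l I := by
  simp [laterTypes]

theorem pairwise_prec_laterTypes (l : Finset (Fin r) → ℕ) : (laterTypes l).Pairwise Prec := by
  have hle : (laterTypes l).Pairwise PrecEq := Finset.pairwise_sort _ _
  have hne : (laterTypes l).Nodup := Finset.sort_nodup _ _
  exact hle.imp₂ (fun I I' h h' => lt_of_le_of_ne h (precKey_injective.ne h')) hne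

theorem isAdmissibleCell_of_mem_canonicalOfSingletons (hl : ∀ j, 0 < l {j})
    (hJ : J ∈ canonicalOfSingletons l) : IsAdmissibleCell l J := by
  refine isAdmissibleCell_of_mem_foldl_extend hl (pairwise_prec_laterTypes l)
    (fun I₀ => mem_laterTypes.1) ?_ hJ
  rintro J rfl
  refine ⟨isAdmissibleCell_initialCell hl, fun I₀ hI₀ I hI => prec_of_card_lt ?_⟩
  exact (card_eq_one_of_initialCell_ne hI).trans_lt (mem_laterTypes.1 hI₀).1

/-! ### Missing singleton types -/

theorem IsAdmissibleCell.eq_singleton_of_forall_pos (hJ : IsAdmissibleCell l J) {i : Fin r}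
    (hpos : ∀ x ∈ minkowskiSum l J, 0 < x i) : J {i} = {i.succ} := by
  obtain ⟨I, hI⟩ := exists_eq_singleton_of_forall_pos hJ.nonempty hpos
  obtain ⟨Y, hY, hker⟩ := hJ.exists_isSeparating I (by simp [hI, (Fin.succ_ne_zero i).symm])
  rw [hI, Finset.singleton_subset_iff] at hY
  have hiI : i ∈ I := succ_mem_withZero.1 (hJ.subset_withZero I (by simp [hI]))
  have hprec : PrecEq {i} I := by
    by_cases hcard : I.card ≤ 1
    · exact Finset.eq_of_subset_of_card_le (Finset.singleton_subset_iff.2 hiI)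
        (by rwa [Finset.card_singleton]) ▸ le_rfl
    · exact (prec_of_card_lt (by rwa [Finset.card_singleton, ← not_le])).precEq
  have hlabels : ∀ v ∈ J {i}, v ∈ labels Y := fun v hv =>
    (edgeSpace_le_ker_coordSum_iff.1 (hker {i} hprec) v hv _ (hJ.succ_mem i)).2 hY
  refine Finset.eq_singleton_iff_unique_mem.2 ⟨hJ.succ_mem i, fun v hv => ?_⟩
  obtain ⟨j, -, rfl⟩ := mem_labels.1 (hlabels v hv)
  rw [Finset.mem_singleton.1 (succ_mem_withZero.1 (hJ.subset_withZero {i} hv))]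

theorem fillSingletons_singleton_pos (l : Finset (Fin r) → ℕ) (j : Fin r) :
    0 < fillSingletons l {j} := by
  simp [fillSingletons]

theorem le_fillSingletons (l : Finset (Fin r) → ℕ) : l ≤ fillSingletons l := by
  intro I
  rw [fillSingletons]
  split_ifs <;> simp

theorem exists_eq_singleton_of_fillSingletons_pos {I : Finset (Fin r)} (hI : l I = 0)
    (hpos : 0 < fillSingletons l I) : ∃ i, I = {i} := by
  refine Finset.card_eq_one.1 (by_contra fun hcard => ?_)
  rw [fillSingletons, if_neg hcard, hI] at hpos
  exact lt_irrefl 0 hpos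

theorem exists_isAdmissibleCell_of_mem_canonicalSubdivision (hJ : J ∈ canonicalSubdivision l) :
    ∃ J', IsAdmissibleCell (fillSingletons l) J' ∧ cellType J = cellType J' ∧
      ∀ I, 0 < l I → J I = J' I := by
  obtain ⟨J', hJ', hregion, hJ⟩ := hJ
  have hadm := isAdmissibleCell_of_mem_canonicalOfSingletons (fillSingletons_singleton_pos l) hJ'
  refine ⟨J', hadm, congrArg collection (funext fun I => ?_), fun I hI => by
    rw [hJ I, if_neg hI.ne']⟩
  rw [hJ I]
  split_ifs with hI
  · by_cases hJI : J' I = {0}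
    · rw [hJI]
    · obtain ⟨i, rfl⟩ := exists_eq_singleton_of_fillSingletons_pos hI (hadm.pos_of_ne I hJI)
      have hpos : ∀ x ∈ minkowskiSum (fillSingletons l) J', 0 < x i := fun x hx =>
        (Nat.cast_pos.2 (fillSingletons_singleton_pos l i)).trans_le (hregion i hI x hx)
      rw [hadm.eq_singleton_of_forall_pos hpos]
      rfl
  · rfl

end Transversalhedron

theorem mainTheorem5_general {r : ℕ} (l : Finset (Fin r) → ℕ)
    (J : Finset (Fin r) → Finset (Fin (r + 1))) (hJ : J ∈ canonicalSubdivision l)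
    (I : Finset (Fin r)) (hI : 0 < l I) : 0 ∉ J I ↔ I ∈ EP (cellType J) := by
  obtain ⟨J', hJ', htype, heq⟩ := exists_isAdmissibleCell_of_mem_canonicalSubdivision hJ
  rw [htype, heq I hI]
  exact hJ'.zero_notMem_iff (hI.trans_le (le_fillSingletons l I))

theorem mainTheorem5 {n r : ℕ} (M : Matroid (Fin n)) (A : Fin r → Finset (Fin n))
    (hA : IsPresentation M A) (hr : M.eRank = r)
    (J : Finset (Fin r) → Finset (Fin (r + 1)))
    (hJ : J ∈ canonicalSubdivision (mult A))
    (I : Finset (Fin r)) (hI : 0 < mult A I) :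
    0 ∉ J I ↔ I ∈ EP (cellType J) :=
  mainTheorem5_general (mult A) J hJ I hI
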